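/- **Conventions.** In a meet-semilattice $L$, an existing join $\bigvee S$ is *distributive* if $a\wedge\bigvee S=\bigvee\{a\wedge s: s\in S\}$ for every $a\in L$ (in particular the join on the right exists). For a regular (infinite) cardinal $\kappa$, $\kappa\mathbf{JD}$ (resp. $\mathbf{JID}$) is the class of bounded distributive lattices in which every existing join of a set of cardinality $<\kappa$ (resp. every existing join) is distributive. Let $A$ be a bounded distributive lattice. $\mathcal{DM}A$ is its Dedekind–MacNeille completion, the complete lattice of normal ideals of $A$, i.e. of downsets $N$ with $N=N^{u\ell}$, where $(\cdot)^u$ and $(\cdot)^\ell$ denote the sets of upper and lower bounds. $A$ is *proHeyting* ($A\in\mathbf{proH}$) if $\{x\in A: a\wedge x\le b\}$ is a normal ideal for all $a,b\in A$. For a meet-semilattice $B$, $\mathcal{BL}B$ is the Bruns–Lakser completion: the complete lattice, ordered by inclusion, of all downsets $E$ of $B$ such that $\bigvee S\in E$ whenever $S\subseteq E$ has a distributive join; $B$ is embedded in it by $b\mapsto{\downarrow}b$, and $\mathcal{BL}_\kappa B$ is the smallest subset of $\mathcal{BL}B$ that contains the image of $B$ and is closed under finite meets and under joins of fewer than $\kappa$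 elements. $A$ is *$\kappa$-proHeyting* ($A\in\kappa\mathbf{proH}$) if $\mathcal{BL}_\kappa(\mathcal{DM}A)=\mathcal{DM}A$. A *Priestley space* is a compact space with a partial order such that whenever $x\not\le y$ there is a clopen upset containing $x$ but not $y$. On an ordered topological space $X$, $\mathsf{cl}$ is the closure in the given topology, $\mathsf{int}_1$ the interior in the topology of open upsets, and $\mathsf{cl}_2$ the closure in the topology of open downsets. An open upset $U$ is a *DM-set* if $\mathsf{int}_1\mathsf{cl}_2(U)=U$; the DM-sets, ordered by inclusion, form a complete lattice $\mathsf{DM}(X)$. A *$\kappa$DM-set* is a union of fewer than $\kappa$ DM-sets. The Priestley space of $A$ is the set of prime filters of $A$, ordered by inclusion, with the topology generated by the sets $\{x: a\in x,\ b\notin x\}$, $a,b\in A$. **Theorem.** 1. Let $X$ be a Priestley space and $\mathcal U\subseteq\mathsf{DM}(X)$. The join $\bigvee\mathcal U$ in $\mathsf{DM}(X)$ is distributive if and only if $\bigvee\mathcal U=\mathsf{int}_1\mathsf{cl}\left(\bigcup\mathcal U\right)$. Let $A$ be a bounded distributive lattice, $X$ the Priestley space of $A$, and $\kappa$ a regular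 cardinal. 2. $\mathcal{DM}A\in\kappa\mathbf{JD}$ if and only if $\mathsf{int}_1\mathsf{cl}_2(U)=\mathsf{int}_1\mathsf{cl}(U)$ for every $\kappa$DM-set $U$ of $X$. 3. $\mathcal{DM}A\in\mathbf{JID}$ if and only if $\mathsf{int}_1\mathsf{cl}_2(U)=\mathsf{int}_1\mathsf{cl}(U)$ for every open upset $U$ of $X$. 4. $A\in\kappa\mathbf{proH}$ if and only if $\mathsf{int}_1\mathsf{cl}_2(U)=\mathsf{int}_1\mathsf{cl}(U)$ for every $\kappa$DM-set $U$ of $X$. 5. $A\in\mathbf{proH}$ if and only if $\mathsf{int}_1\mathsf{cl}_2(U)=\mathsf{int}_1\mathsf{cl}(U)$ for every open upset $U$ of $X$. -/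

import Mathlib

universe u v

namespace BrunsLakser

/-! ### Distributive joins, relative annihilators and classes of lattices -/

/-- `s` is the join of `S`, and this join is distributive: `a ⊓ s` is the join of
`{a ⊓ t | t ∈ S}` for every `a`. -/
def IsDistributiveJoin {A : Type u} [SemilatticeInf A] (S : Set A) (s : A) : Prop :=
  IsLUB S s ∧ ∀ a : A, IsLUB ((fun t => a ⊓ t) '' S) (a ⊓ s)

/-- `κ`-join distributivity: every existing join of fewer than `κ` elements is distributive. -/
def IsKJD (κ : Cardinal.{u}) (A : Type u) [SemilatticeInf A] : Prop :=
  ∀ S : Set A, Cardinal.mk S < κ → ∀ s : A, IsLUB S s → IsDistributiveJoin S s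

/-- Join infinite distributivity: every existing join is distributive. -/
def IsJID (A : Type u) [SemilatticeInf A] : Prop :=
  ∀ (S : Set A) (s : A), IsLUB S s → IsDistributiveJoin S s

/-- The lattice satisfies the finite distributive law. -/
def IsDistributive (L : Type u) [Lattice L] : Prop :=
  ∀ x y z : L, x ⊓ (y ⊔ z) = (x ⊓ y) ⊔ (x ⊓ z)

/-- Membership of a bounded lattice in the class `κJD` of bounded distributive lattices that are
`κ`-join distributive. -/
def MemKJD (κ : Cardinal.{u}) (L : Type u) [Lattice L] [BoundedOrder L] : Prop :=
  IsDistributive L ∧ IsKJD κ L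

/-- Membership of a bounded lattice in the class `JID` of bounded distributive lattices that are
join infinite distributive. -/
def MemJID (L : Type u) [Lattice L] [BoundedOrder L] : Prop :=
  IsDistributive L ∧ IsJID L

/-- The relative annihilator `⟨a, b⟩`. -/
def relAnnihilator {A : Type u} [SemilatticeInf A] (a b : A) : Set A :=
  {x | a ⊓ x ≤ b}

/-- A normal ideal: a downset `N` with `N = Nᵘˡ`. -/
def IsNormalIdeal {A : Type u} [Preorder A] (N : Set A) : Prop :=
  IsLowerSet N ∧ lowerBounds (upperBounds N) = N

/-- `A` is proHeyting: all its relative annihilators are normal ideals. -/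
def IsProHeyting (A : Type u) [SemilatticeInf A] : Prop :=
  ∀ a b : A, IsNormalIdeal (relAnnihilator a b)

/-! ### The Bruns-Lakser completion and its tower -/

/-- `S` is admissible: its join exists and is distributive. -/
def IsAdmissible {A : Type u} [SemilatticeInf A] (S : Set A) : Prop :=
  ∃ s : A, IsDistributiveJoin S s

/-- A D-ideal: a downset closed under the joins of its admissible subsets. -/
def IsDIdeal {A : Type u} [SemilatticeInf A] (E : Set A) : Prop :=
  IsLowerSet E ∧ ∀ S : Set A, S ⊆ E → ∀ s : A, IsDistributiveJoin S s → s ∈ E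

/-- The Bruns-Lakser completion of `A`: the collection of its D-ideals, ordered by inclusion. -/
def BL (A : Type u) [SemilatticeInf A] : Type u :=
  {E : Set A // IsDIdeal E}

namespace BL

variable {A : Type u} [SemilatticeInf A]

instance : PartialOrder (BL A) :=
  inferInstanceAs (PartialOrder {E : Set A // IsDIdeal E})

theorem isDIdeal_sInter (T : Set (BL A)) : IsDIdeal (⋂ E ∈ T, E.1) := by
  refine ⟨isLowerSet_iInter₂ fun E _ => E.2.1, fun S hS s hs => ?_⟩
  refine Set.mem_iInter₂.2 fun E hE => E.2.2 S (fun x hx => ?_) s hs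
  exact Set.mem_iInter₂.1 (hS hx) E hE

instance : InfSet (BL A) := ⟨fun T => ⟨⋂ E ∈ T, E.1, isDIdeal_sInter T⟩⟩

/-- The D-ideals form a complete lattice in which infima are intersections. -/
instance : CompleteLattice (BL A) :=
  completeLatticeOfInf (BL A) fun T =>
    ⟨fun E hE => Set.biInter_subset_of_mem (t := fun E : BL A => E.1) hE,
      fun _ hE => Set.subset_iInter₂ fun F hF => hE hF⟩

/-- The principal downset `↓a` as a D-ideal; this is the embedding of `A` into its Bruns-Lakser
completion along which `A` is regarded as a subset of the completion. -/
def principal (a : A) : BL A :=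
  ⟨Set.Iic a, isLowerSet_Iic a, fun _ hS _ hs => hs.1.2 fun _ hx => hS hx⟩

end BL

/-- A sub-`κ`-frame of a complete lattice `L`: a subset closed under finite meets (including the
empty one) and under joins, formed in `L`, of fewer than `κ` elements. -/
def IsSubKFrame (κ : Cardinal.{u}) {L : Type u} [CompleteLattice L] (T : Set L) : Prop :=
  ⊤ ∈ T ∧ (∀ x ∈ T, ∀ y ∈ T, x ⊓ y ∈ T) ∧ ∀ S : Set L, S ⊆ T → Cardinal.mk S < κ → sSup S ∈ T

/-- The `κ`-th stage of the Bruns-Lakser tower of `A`: the sub-`κ`-frame of the Bruns-Lakser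
completion generated by `A`. -/
def BLTower (κ : Cardinal.{u}) (A : Type u) [SemilatticeInf A] : Set (BL A) :=
  ⋂₀ {T | IsSubKFrame κ T ∧ Set.range BL.principal ⊆ T}

/-- `A` is `κ`-proHeyting: the `κ`-th stage of the Bruns-Lakser tower of the Dedekind-MacNeille
completion `DM` of `A` is `DM` itself. -/
def IsKProHeyting (κ : Cardinal.{u}) (A : Type u) [SemilatticeInf A] : Prop :=
  BLTower κ (DedekindCut A) = Set.range BL.principal

/-! ### Dedekind-MacNeille sets of an ordered space -/

section OrderedSpace

variable (X : Type u) [PartialOrder X] [TopologicalSpace X]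

/-- The topology of open upsets. -/
@[reducible]
def upsetTopology : TopologicalSpace X where
  IsOpen U := IsOpen U ∧ IsUpperSet U
  isOpen_univ := ⟨isOpen_univ, isUpperSet_univ⟩
  isOpen_inter _ _ hU hV := ⟨hU.1.inter hV.1, hU.2.inter hV.2⟩
  isOpen_sUnion _ h := ⟨isOpen_sUnion fun U hU => (h U hU).1, isUpperSet_sUnion fun U hU => (h U hU).2⟩

/-- The topology of open downsets. -/
@[reducible]
def downsetTopology : TopologicalSpace X where
  IsOpen U := IsOpen U ∧ IsLowerSet U
  isOpen_univ := ⟨isOpen_univ, isLowerSet_univ⟩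
  isOpen_inter _ _ hU hV := ⟨hU.1.inter hV.1, hU.2.inter hV.2⟩
  isOpen_sUnion _ h := ⟨isOpen_sUnion fun U hU => (h U hU).1, isLowerSet_sUnion fun U hU => (h U hU).2⟩

variable {X}

/-- The interior `int₁` in the topology of open upsets. -/
def int₁ (S : Set X) : Set X := @interior X (upsetTopology X) S

/-- The closure `cl₂` in the topology of open downsets. -/
def cl₂ (S : Set X) : Set X := @closure X (downsetTopology X) S

/-- An open upset. -/
def IsOpenUpset (U : Set X) : Prop := IsOpen U ∧ IsUpperSet U

/-- A Dedekind-MacNeille set: an open upset `U` with `int₁ (cl₂ U) = U`. -/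
def IsDMSet (U : Set X) : Prop := IsOpenUpset U ∧ int₁ (cl₂ U) = U

theorem int₁_isOpenUpset (S : Set X) : IsOpenUpset (int₁ S) :=
  @isOpen_interior X (upsetTopology X) S

theorem int₁_subset (S : Set X) : int₁ S ⊆ S :=
  @interior_subset X (upsetTopology X) S

theorem int₁_maximal {U S : Set X} (hU : IsOpenUpset U) (h : U ⊆ S) : U ⊆ int₁ S :=
  @interior_maximal X (upsetTopology X) S U h hU

theorem int₁_cl₂_mono {S T : Set X} (h : S ⊆ T) : int₁ (cl₂ S) ⊆ int₁ (cl₂ T) :=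
  @interior_mono X (upsetTopology X) _ _ (@closure_mono X (downsetTopology X) _ _ h)

theorem subset_int₁_cl₂ {U : Set X} (hU : IsOpenUpset U) : U ⊆ int₁ (cl₂ U) :=
  int₁_maximal hU (@subset_closure X (downsetTopology X) U)

theorem isDMSet_int₁_cl₂ (S : Set X) : IsDMSet (int₁ (cl₂ S)) := by
  refine ⟨int₁_isOpenUpset _, (Set.Subset.antisymm ?_ (subset_int₁_cl₂ (int₁_isOpenUpset _)))⟩
  refine @interior_mono X (upsetTopology X) _ _ ?_
  exact @closure_minimal X (downsetTopology X) _ _ (int₁_subset _)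
    (@isClosed_closure X (downsetTopology X) S)

theorem IsDMSet.inter {U V : Set X} (hU : IsDMSet U) (hV : IsDMSet V) : IsDMSet (U ∩ V) := by
  have h : IsOpenUpset (U ∩ V) := ⟨hU.1.1.inter hV.1.1, hU.1.2.inter hV.1.2⟩
  refine ⟨h, Set.Subset.antisymm (Set.subset_inter ?_ ?_) (subset_int₁_cl₂ h)⟩
  · exact (int₁_cl₂_mono Set.inter_subset_left).trans hU.2.le
  · exact (int₁_cl₂_mono Set.inter_subset_right).trans hV.2.le

variable (X) in
/-- The collection `DM(X)` of Dedekind-MacNeille sets of `X`, ordered by inclusion. -/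
def DMSets : Type u := {U : Set X // IsDMSet U}

namespace DMSets

instance : PartialOrder (DMSets X) :=
  inferInstanceAs (PartialOrder {U : Set X // IsDMSet U})

instance : SupSet (DMSets X) := ⟨fun 𝒰 => ⟨int₁ (cl₂ (⋃ U ∈ 𝒰, U.1)), isDMSet_int₁_cl₂ _⟩⟩

theorem isLUB_sSup (𝒰 : Set (DMSets X)) : IsLUB 𝒰 (sSup 𝒰) := by
  refine ⟨fun U hU => ?_, fun W hW => ?_⟩
  · change U.1 ⊆ int₁ (cl₂ (⋃ V ∈ 𝒰, V.1))
    exact (subset_int₁_cl₂ U.2.1).trans (int₁_cl₂_mono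
      (Set.subset_biUnion_of_mem (u := fun V : DMSets X => V.1) hU))
  · change int₁ (cl₂ (⋃ V ∈ 𝒰, V.1)) ⊆ W.1
    have h : (⋃ V ∈ 𝒰, V.1) ⊆ W.1 := Set.iUnion₂_subset fun V hV => hW hV
    exact (int₁_cl₂_mono h).trans (le_of_eq W.2.2)

/-- `DM(X)` is a complete lattice; binary meets are intersections. -/
instance : CompleteLattice (DMSets X) where
  __ := completeLatticeOfSup (DMSets X) isLUB_sSup
  inf U V := ⟨U.1 ∩ V.1, U.2.inter V.2⟩
  inf_le_left _ _ := Set.inter_subset_left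
  inf_le_right _ _ := Set.inter_subset_right
  le_inf _ _ _ hU hV := Set.subset_inter hU hV

end DMSets

/-- A `κDM`-set: a union of fewer than `κ` Dedekind-MacNeille sets. -/
def IsKDMSet (κ : Cardinal.{u}) (U : Set X) : Prop :=
  ∃ 𝒰 : Set (DMSets X), Cardinal.mk 𝒰 < κ ∧ U = ⋃ V ∈ 𝒰, V.1

end OrderedSpace

/-! ### The Priestley space of a bounded distributive lattice -/

/-- The set of prime filters of `A`. -/
def PriestleyDual (A : Type u) [DistribLattice A] [BoundedOrder A] : Type u :=
  {F : Order.PFilter A // F.IsPrime}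

namespace PriestleyDual

variable {A : Type u} [DistribLattice A] [BoundedOrder A]

/-- The Stone map `𝔰(a) = {x | a ∈ x}`. -/
def stone (a : A) : Set (PriestleyDual A) := {x | a ∈ x.1}

/-- Prime filters are ordered by inclusion. -/
instance : PartialOrder (PriestleyDual A) :=
  PartialOrder.lift (fun x => (x.1 : Set A)) fun _ _ h => Subtype.ext (SetLike.coe_injective h)

/-- The topology generated by the sets `𝔰(a) \ 𝔰(b)`. -/
instance : TopologicalSpace (PriestleyDual A) :=
  TopologicalSpace.generateFrom {W | ∃ a b : A, W = stone a \ stone b}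

end PriestleyDual

end BrunsLakser

namespace BrunsLakser

/-! ### Distributive joins in complete lattices -/

section Lattice

variable {L : Type u} [CompleteLattice L] {κ : Cardinal.{u}}

/-! In `DMSets X` meets are intersections and the join of `𝒰` is `int₁ (cl₂ O)` with `O = ⋃ 𝒰`.
Everything reduces to one inclusion: the join is distributive iff `int₁ (cl₂ O) ⊆ closure O`. If the
inclusion holds, meeting with an open `V` stays inside `closure (V ∩ O)`, so any DM-set containing
`V ∩ O` contains the meet. If it fails at `x`, Priestley separation gives clopen upsets `V`, `W`
with `x ∈ V \ W` and `V ∩ O ⊆ W`. Clopen upsets are DM-sets, so `V` and `W` refute distributivity.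

For a lattice `A` with dual space `X`, `stone c ⊆ cl₂ (openUpset S)` means that `c` lies below every
upper bound of `S`. Hence cuts of `A` correspond to DM-sets (`dedekindCutIso`), which carries the
criterion to the completion. Every open upset is a union of DM-sets, so `IsJID` tests all open
upsets.

A join of principal D-ideals is principal exactly when the underlying join is distributive, so a
complete lattice is its own `κ`-th tower stage iff it is `κ`-join distributive.

The proHeyting condition is matched directly (`isProHeyting_iff`): relative annihilators encode the
open upsets disjoint from a basic open set `stone a \ stone b`. -/

theorem isDistributive_of_pair {L : Type u} [Lattice L]
    (h : ∀ y z : L, IsDistributiveJoin {y, z} (y ⊔ z)) : IsDistributive L := by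
  intro x y z
  have h' := (h y z).2 x
  rw [Set.image_pair] at h'
  exact h'.unique isLUB_pair

theorem isKJD_iff : IsKJD κ L ↔
    ∀ S : Set L, Cardinal.mk S < κ → IsDistributiveJoin S (sSup S) := by
  refine ⟨fun h S hS => h S hS _ (isLUB_sSup S), fun h S hS s hs => ?_⟩
  rw [← hs.sSup_eq]
  exact h S hS

theorem isJID_iff : IsJID L ↔ ∀ S : Set L, IsDistributiveJoin S (sSup S) := by
  refine ⟨fun h S => h S _ (isLUB_sSup S), fun h S s hs => ?_⟩
  rw [← hs.sSup_eq]
  exact h S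

/-- The finite law comes for free, since a pair has fewer than `κ` elements when `κ` is infinite. -/
theorem memKJD_iff (hκ : Cardinal.aleph0 ≤ κ) : MemKJD κ L ↔ IsKJD κ L := by
  refine ⟨fun h => h.2, fun h => ⟨isDistributive_of_pair fun y z => ?_, h⟩⟩
  exact h _ ((Cardinal.lt_aleph0_of_finite _).trans_le hκ) _ isLUB_pair

theorem memJID_iff : MemJID L ↔ IsJID L :=
  ⟨fun h => h.2, fun h => ⟨isDistributive_of_pair fun _ _ => h _ _ isLUB_pair, h⟩⟩

theorem isDistributiveJoin_orderIso {M N : Type*} [SemilatticeInf M] [SemilatticeInf N]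
    (e : M ≃o N) {S : Set M} {s : M} :
    IsDistributiveJoin (e '' S) (e s) ↔ IsDistributiveJoin S s := by
  have key (a : M) : (fun t => e a ⊓ t) '' (e '' S) = e '' ((fun t => a ⊓ t) '' S) := by
    simp only [Set.image_image, e.map_inf]
  unfold IsDistributiveJoin
  rw [e.isLUB_image', e.surjective.forall]
  simp only [key, ← e.map_inf, e.isLUB_image']

theorem IsKJD.orderIso {M : Type u} [CompleteLattice M] (e : L ≃o M) (h : IsKJD κ L) :
    IsKJD κ M := by
  intro S hS s hs
  have hj := h (e.symm '' S) (by rwa [Cardinal.mk_image_eq e.symm.injective]) (e.symm s)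
    (e.symm.isLUB_image'.2 hs)
  exact (isDistributiveJoin_orderIso e.symm).1 hj

theorem IsJID.orderIso {M : Type u} [CompleteLattice M] (e : L ≃o M) (h : IsJID L) :
    IsJID M := fun S s hs =>
  (isDistributiveJoin_orderIso e.symm).1 (h (e.symm '' S) (e.symm s) (e.symm.isLUB_image'.2 hs))

end Lattice

/-! ### The Bruns-Lakser tower of a complete lattice -/

section Tower

variable {L : Type u} [CompleteLattice L] {κ : Cardinal.{u}}

/-- Closure under a join uses only its distributivity at `a`. These D-ideals therefore serve as test
objects for detecting distributivity. -/
theorem isDIdeal_relAnnihilator {B : Type u} [SemilatticeInf B] (a c : B) :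
    IsDIdeal (relAnnihilator a c) := by
  refine ⟨fun x y hyx hx => (inf_le_inf_left a hyx).trans hx, fun S hS s hs => ?_⟩
  refine (hs.2 a).2 ?_
  rintro _ ⟨t, ht, rfl⟩
  exact hS ht

theorem BL.principal_le_iff {B : Type u} [SemilatticeInf B] {b : B} {E : BL B} :
    BL.principal b ≤ E ↔ b ∈ E.1 :=
  ⟨fun h => h (Set.mem_Iic.2 le_rfl), fun h _ hx => E.2.1 hx h⟩

theorem IsDistributiveJoin.isLUB_principal {B : Type u} [SemilatticeInf B] {S : Set B} {s : B}
    (h : IsDistributiveJoin S s) : IsLUB (BL.principal '' S) (BL.principal s) := by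
  constructor
  · rintro _ ⟨t, ht, rfl⟩
    exact BL.principal_le_iff.2 (h.1.1 ht)
  · intro E hE
    exact BL.principal_le_iff.2
      (E.2.2 S (fun t ht => BL.principal_le_iff.1 (hE ⟨t, ht, rfl⟩)) s h)

theorem isDistributiveJoin_of_isLUB_principal {B : Type u} [SemilatticeInf B] {S : Set B} {s : B}
    (h : IsLUB (BL.principal '' S) (BL.principal s)) : IsDistributiveJoin S s := by
  have hub : ∀ t ∈ S, t ≤ s := fun t ht => BL.principal_le_iff.1 (h.1 ⟨t, ht, rfl⟩)
  refine ⟨⟨hub, fun c hc => ?_⟩, fun a => ⟨?_, fun c hc => ?_⟩⟩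
  · refine BL.principal_le_iff.1 (h.2 (show BL.principal c ∈ upperBounds _ from ?_))
    rintro _ ⟨t, ht, rfl⟩
    exact BL.principal_le_iff.2 (hc ht)
  · rintro _ ⟨t, ht, rfl⟩
    exact inf_le_inf_left a (hub t ht)
  -- An upper bound `c` of the meets `a ⊓ t` says that the relative annihilator of `a` and `c`
  -- contains `S`; as a D-ideal it then contains `s`.
  · refine BL.principal_le_iff.1
      (h.2 (show (⟨_, isDIdeal_relAnnihilator a c⟩ : BL B) ∈ upperBounds _ from ?_))
    rintro _ ⟨t, ht, rfl⟩
    exact BL.principal_le_iff.2 (hc ⟨t, ht, rfl⟩)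

theorem BL.principal_injective {B : Type u} [SemilatticeInf B] :
    Function.Injective (BL.principal : B → BL B) := fun _ _ h =>
  le_antisymm (BL.principal_le_iff.1 h.le) (BL.principal_le_iff.1 h.ge)

theorem BL.principal_inf {B : Type u} [SemilatticeInf B] (a b : B) :
    BL.principal a ⊓ BL.principal b = BL.principal (a ⊓ b) := by
  apply le_antisymm
  · intro x hx
    exact le_inf ((inf_le_left : BL.principal a ⊓ BL.principal b ≤ _) hx)
      ((inf_le_right : BL.principal a ⊓ BL.principal b ≤ _) hx)
  · exact le_inf (BL.principal_le_iff.2 inf_le_left) (BL.principal_le_iff.2 inf_le_right)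

theorem isSubKFrame_range_principal (h : IsKJD κ L) :
    IsSubKFrame κ (Set.range (BL.principal : L → BL L)) := by
  refine ⟨⟨⊤, top_le_iff.1 fun _ _ => Set.mem_Iic.2 le_top⟩, ?_, fun S hS hκ => ?_⟩
  · rintro _ ⟨a, rfl⟩ _ ⟨b, rfl⟩
    exact ⟨_, (BL.principal_inf a b).symm⟩
  · obtain ⟨T, rfl⟩ := Set.subset_range_iff_exists_image_eq.1 hS
    rw [Cardinal.mk_image_eq BL.principal_injective] at hκ
    exact ⟨sSup T, (isKJD_iff.1 h T hκ).isLUB_principal.sSup_eq.symm⟩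

theorem isSubKFrame_BLTower {B : Type u} [SemilatticeInf B] : IsSubKFrame κ (BLTower κ B) :=
  ⟨fun _ hT => hT.1.1, fun x hx y hy T hT => hT.1.2.1 x (hx T hT) y (hy T hT),
    fun S hS hκ T hT => hT.1.2.2 S (fun _ hx => hS hx T hT) hκ⟩

theorem range_principal_subset_BLTower {B : Type u} [SemilatticeInf B] :
    Set.range BL.principal ⊆ BLTower κ B := fun _ hx _ hT => hT.2 hx

/-- Under `κ`-join distributivity the principal ideals already form a sub-`κ`-frame. Conversely, a
join of fewer than `κ` principal ideals lies in the tower, so it is principal, which forces the join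
in `L` to be distributive. -/
theorem BLTower_eq_range_principal_iff :
    BLTower κ L = Set.range BL.principal ↔ IsKJD κ L := by
  refine ⟨fun h => isKJD_iff.2 fun S hS => ?_, fun h => Set.Subset.antisymm
    (fun _ hx => hx _ ⟨isSubKFrame_range_principal h, le_rfl⟩) range_principal_subset_BLTower⟩
  have hmem : sSup (BL.principal '' S) ∈ BLTower κ L :=
    isSubKFrame_BLTower.2.2 _ ((Set.image_subset_range _ _).trans range_principal_subset_BLTower)
      (Cardinal.mk_image_le.trans_lt hS)
  rw [h] at hmem
  obtain ⟨b, hb⟩ := hmem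
  have hlub := isLUB_sSup (BL.principal '' S)
  rw [← hb] at hlub
  have hj := isDistributiveJoin_of_isLUB_principal hlub
  rwa [hj.1.sSup_eq]

end Tower

/-! ### Separation in Priestley spaces and distributive joins of DM-sets -/

section Space

variable {X : Type u} [PartialOrder X] [TopologicalSpace X]

theorem closure_subset_cl₂ (S : Set X) : closure S ⊆ cl₂ S := by
  refine closure_minimal (@subset_closure X (downsetTopology X) S) ?_
  exact ⟨(@isClosed_closure X (downsetTopology X) S).isOpen_compl.1⟩

theorem isUpperSet_cl₂ (S : Set X) : IsUpperSet (cl₂ S) :=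
  isLowerSet_compl.1 (@isClosed_closure X (downsetTopology X) S).isOpen_compl.2

theorem isClosed_cl₂ (S : Set X) : IsClosed (cl₂ S) :=
  ⟨(@isClosed_closure X (downsetTopology X) S).isOpen_compl.1⟩

theorem subset_cl₂ (S : Set X) : S ⊆ cl₂ S := @subset_closure X (downsetTopology X) S

theorem cl₂_minimal {S C : Set X} (h : S ⊆ C) (hC : IsClosed C) (hC' : IsUpperSet C) :
    cl₂ S ⊆ C :=
  @closure_minimal X (downsetTopology X) S C h
    (@IsClosed.mk X (downsetTopology X) C ⟨hC.isOpen_compl, hC'.compl⟩)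

theorem int₁_mono {S T : Set X} (h : S ⊆ T) : int₁ S ⊆ int₁ T :=
  int₁_maximal (int₁_isOpenUpset S) ((int₁_subset S).trans h)

/-- The complement is an open downset, so `cl₂` fixes a clopen upset. -/
theorem isDMSet_of_isClopen {U : Set X} (hU : IsClopen U) (hU' : IsUpperSet U) : IsDMSet U :=
  ⟨⟨hU.2, hU'⟩, Set.Subset.antisymm
    ((int₁_subset _).trans (cl₂_minimal le_rfl hU.1 hU')) (subset_int₁_cl₂ ⟨hU.2, hU'⟩)⟩

/-- A closed set in a compact Priestley space is separated from an outside point by a difference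
of clopen upsets. -/
theorem exists_isClopen_diff_disjoint [CompactSpace X] [PriestleySpace X] {C : Set X}
    (hC : IsClosed C) {x : X} (hx : x ∉ C) :
    ∃ V W : Set X, (IsClopen V ∧ IsUpperSet V) ∧ (IsClopen W ∧ IsUpperSet W) ∧
      x ∈ V ∧ x ∉ W ∧ V ∩ C ⊆ W := by
  refine hC.isCompact.induction_on (p := fun C => ∃ V W : Set X, (IsClopen V ∧ IsUpperSet V) ∧
    (IsClopen W ∧ IsUpperSet W) ∧ x ∈ V ∧ x ∉ W ∧ V ∩ C ⊆ W) ?_ ?_ ?_ ?_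
  · exact ⟨Set.univ, ∅, ⟨isClopen_univ, isUpperSet_univ⟩, ⟨isClopen_empty, isUpperSet_empty⟩,
      trivial, id, by simp⟩
  · rintro s t hst ⟨V, W, hV, hW, hxV, hxW, h⟩
    exact ⟨V, W, hV, hW, hxV, hxW, (Set.inter_subset_inter_right V hst).trans h⟩
  · rintro s t ⟨V, W, hV, hW, hxV, hxW, h⟩ ⟨V', W', hV', hW', hxV', hxW', h'⟩
    refine ⟨V ∩ V', W ∪ W', ⟨hV.1.inter hV'.1, hV.2.inter hV'.2⟩,
      ⟨hW.1.union hW'.1, hW.2.union hW'.2⟩, ⟨hxV, hxV'⟩, not_or.2 ⟨hxW, hxW'⟩, ?_⟩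
    rintro y ⟨⟨hy, hy'⟩, hys | hyt⟩
    exacts [Or.inl (h ⟨hy, hys⟩), Or.inr (h' ⟨hy', hyt⟩)]
  · intro y hy
    have hne : x ≠ y := fun h => hx (h ▸ hy)
    -- Distinct points are separated by a clopen upset containing just one of them. It becomes `V`
    -- if it contains `x`, and `W` if it contains `y`; the other set is trivial.
    obtain h | h := hne.not_le_or_not_ge
    · obtain ⟨V, hV, hV', hxV, hyV⟩ := exists_isClopen_upper_of_not_le h
      refine ⟨Vᶜ, mem_nhdsWithin_of_mem_nhds (hV.compl.2.mem_nhds hyV), V, ∅, ⟨hV, hV'⟩,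
        ⟨isClopen_empty, isUpperSet_empty⟩, hxV, id, ?_⟩
      simp
    · obtain ⟨W, hW, hW', hyW, hxW⟩ := exists_isClopen_upper_of_not_le h
      exact ⟨W, mem_nhdsWithin_of_mem_nhds (hW.2.mem_nhds hyW), Set.univ, W,
        ⟨isClopen_univ, isUpperSet_univ⟩, ⟨hW, hW'⟩, trivial, hxW, Set.inter_subset_right⟩

theorem DMSets.coe_sSup (𝒰 : Set (DMSets X)) :
    (sSup 𝒰).1 = int₁ (cl₂ (⋃ U ∈ 𝒰, U.1)) := rfl

/-- Unlike `cl₂`, the topological closure is compatible with meeting an open set: `V ∩ closure O ⊆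
closure (V ∩ O)`. -/
theorem DMSets.isDistributiveJoin_of_subset_closure {𝒰 : Set (DMSets X)}
    (h : (sSup 𝒰).1 ⊆ closure (⋃ U ∈ 𝒰, U.1)) : IsDistributiveJoin 𝒰 (sSup 𝒰) := by
  refine ⟨DMSets.isLUB_sSup 𝒰, fun V => ⟨?_, fun W hW => ?_⟩⟩
  · rintro _ ⟨U, hU, rfl⟩
    exact inf_le_inf_left V ((DMSets.isLUB_sSup 𝒰).1 hU)
  · have hVW : V.1 ∩ ⋃ U ∈ 𝒰, U.1 ⊆ W.1 := by
      rintro x ⟨hxV, hx⟩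
      obtain ⟨U, hU, hxU⟩ := Set.mem_iUnion₂.1 hx
      exact hW ⟨U, hU, rfl⟩ ⟨hxV, hxU⟩
    change V.1 ∩ (sSup 𝒰).1 ⊆ W.1
    rw [← W.2.2]
    refine int₁_maximal ⟨V.2.1.1.inter (sSup 𝒰).2.1.1, V.2.1.2.inter (sSup 𝒰).2.1.2⟩ ?_
    calc V.1 ∩ (sSup 𝒰).1 ⊆ V.1 ∩ closure (⋃ U ∈ 𝒰, U.1) := Set.inter_subset_inter_right _ h
      _ ⊆ closure (V.1 ∩ ⋃ U ∈ 𝒰, U.1) := V.2.1.1.inter_closure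
      _ ⊆ closure W.1 := closure_mono hVW
      _ ⊆ cl₂ W.1 := closure_subset_cl₂ _

theorem DMSets.subset_closure_of_isDistributiveJoin [CompactSpace X] [PriestleySpace X]
    {𝒰 : Set (DMSets X)} (h : IsDistributiveJoin 𝒰 (sSup 𝒰)) :
    (sSup 𝒰).1 ⊆ closure (⋃ U ∈ 𝒰, U.1) := by
  intro x hx
  by_contra hxc
  obtain ⟨V, W, hV, hW, hxV, hxW, hVW⟩ := exists_isClopen_diff_disjoint isClosed_closure hxc
  let V' : DMSets X := ⟨V, isDMSet_of_isClopen hV.1 hV.2⟩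
  let W' : DMSets X := ⟨W, isDMSet_of_isClopen hW.1 hW.2⟩
  have hle : V' ⊓ sSup 𝒰 ≤ W' := by
    refine (h.2 V').2 ?_
    rintro _ ⟨U, hU, rfl⟩ y ⟨hyV, hyU⟩
    exact hVW ⟨hyV, subset_closure (Set.mem_biUnion hU hyU)⟩
  exact hxW (hle (show x ∈ V ∩ (sSup 𝒰).1 from ⟨hxV, hx⟩))

/-- Only one inclusion has content, because `closure U ⊆ cl₂ U` always holds. -/
theorem int₁_cl₂_eq_iff {U : Set X} :
    int₁ (cl₂ U) = int₁ (closure U) ↔ int₁ (cl₂ U) ⊆ closure U :=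
  ⟨fun h => h ▸ int₁_subset _, fun h => Set.Subset.antisymm
    (int₁_maximal (int₁_isOpenUpset _) h) (int₁_mono (closure_subset_cl₂ U))⟩

theorem DMSets.isDistributiveJoin_iff [CompactSpace X] [PriestleySpace X] (𝒰 : Set (DMSets X)) :
    IsDistributiveJoin 𝒰 (sSup 𝒰) ↔ (sSup 𝒰).1 = int₁ (closure (⋃ U ∈ 𝒰, U.1)) := by
  rw [DMSets.coe_sSup, int₁_cl₂_eq_iff]
  exact ⟨DMSets.subset_closure_of_isDistributiveJoin, DMSets.isDistributiveJoin_of_subset_closure⟩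

theorem isKJD_DMSets_iff [CompactSpace X] [PriestleySpace X] {κ : Cardinal.{u}} :
    IsKJD κ (DMSets X) ↔
      ∀ U : Set X, IsKDMSet κ U → int₁ (cl₂ U) = int₁ (closure U) := by
  rw [isKJD_iff]
  constructor
  · rintro h _ ⟨𝒰, h𝒰, rfl⟩
    exact (DMSets.isDistributiveJoin_iff 𝒰).1 (h 𝒰 h𝒰)
  · intro h 𝒰 h𝒰
    exact (DMSets.isDistributiveJoin_iff 𝒰).2 (h _ ⟨𝒰, h𝒰, rfl⟩)

/-- In a compact Priestley space an open upset is a union of clopen upsets. -/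
theorem IsOpenUpset.exists_isClopen [CompactSpace X] [PriestleySpace X] {U : Set X}
    (hU : IsOpenUpset U) {x : X} (hx : x ∈ U) :
    ∃ V : Set X, IsClopen V ∧ IsUpperSet V ∧ x ∈ V ∧ V ⊆ U := by
  obtain ⟨V, hV, hV', hxV, hVU⟩ := hU.1.isClosed_compl.isCompact.induction_on
    (p := fun C => ∃ V : Set X, IsClopen V ∧ IsUpperSet V ∧ x ∈ V ∧ V ⊆ Cᶜ)
    ⟨Set.univ, isClopen_univ, isUpperSet_univ, trivial, by simp⟩
    (fun s t hst ⟨V, hV, hV', hxV, h⟩ =>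
      ⟨V, hV, hV', hxV, h.trans (Set.compl_subset_compl.2 hst)⟩)
    (fun s t ⟨V, hV, hV', hxV, h⟩ ⟨W, hW, hW', hxW, h'⟩ =>
      ⟨V ∩ W, hV.inter hW, hV'.inter hW', ⟨hxV, hxW⟩, by
        rw [Set.compl_union]; exact Set.inter_subset_inter h h'⟩)
    (fun y hy => by
      obtain ⟨V, hV, hV', hxV, hyV⟩ :=
        exists_isClopen_upper_of_not_le (fun hxy : x ≤ y => hy (hU.2 hxy hx))
      exact ⟨Vᶜ, mem_nhdsWithin_of_mem_nhds (hV.compl.2.mem_nhds hyV), V, hV, hV', hxV, by simp⟩)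
  exact ⟨V, hV, hV', hxV, by simpa using hVU⟩

theorem isJID_DMSets_iff [CompactSpace X] [PriestleySpace X] :
    IsJID (DMSets X) ↔
      ∀ U : Set X, IsOpenUpset U → int₁ (cl₂ U) = int₁ (closure U) := by
  rw [isJID_iff]
  constructor
  · intro h U hU
    -- Clopen upsets are DM-sets, so the DM-sets inside `U` already cover it.
    have hU' : U = ⋃ V ∈ {V : DMSets X | V.1 ⊆ U}, V.1 := by
      refine Set.Subset.antisymm (fun x hx => ?_) (Set.iUnion₂_subset fun V hV => hV)
      obtain ⟨V, hV, hV', hxV, hVU⟩ := hU.exists_isClopen hx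
      exact Set.mem_iUnion₂.2 ⟨⟨V, isDMSet_of_isClopen hV hV'⟩, hVU, hxV⟩
    rw [hU']
    exact (DMSets.isDistributiveJoin_iff _).1 (h _)
  · intro h 𝒰
    exact (DMSets.isDistributiveJoin_iff 𝒰).2 (h _ ⟨isOpen_biUnion fun V _ => V.2.1.1,
      isUpperSet_iUnion₂ fun V _ => V.2.1.2⟩)

end Space

/-! ### The Priestley space of a bounded distributive lattice -/

namespace PriestleyDual

variable {A : Type u} [DistribLattice A] [BoundedOrder A]

open Order Topology

theorem le_iff {x y : PriestleyDual A} : x ≤ y ↔ ∀ a ∈ x.1, a ∈ y.1 := Iff.rfl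

theorem bot_notMem (x : PriestleyDual A) : ⊥ ∉ x.1 := by
  obtain ⟨b, hb⟩ := x.2.compl_ideal.Nonempty
  exact fun h => hb (PFilter.mem_of_le bot_le h)

theorem sup_mem_iff {x : PriestleyDual A} {a b : A} : a ⊔ b ∈ x.1 ↔ a ∈ x.1 ∨ b ∈ x.1 := by
  refine ⟨fun h => ?_, fun h => h.elim (PFilter.mem_of_le le_sup_left)
    (PFilter.mem_of_le le_sup_right)⟩
  by_contra! hab
  have ha : a ∈ x.2.compl_ideal.toIdeal := hab.1
  have hb : b ∈ x.2.compl_ideal.toIdeal := hab.2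
  exact Ideal.sup_mem ha hb h

@[simp] theorem stone_top : stone (⊤ : A) = Set.univ :=
  Set.eq_univ_of_forall fun _ => PFilter.top_mem

@[simp] theorem stone_bot : stone (⊥ : A) = ∅ := Set.eq_empty_of_forall_notMem bot_notMem

theorem stone_inf (a b : A) : stone (a ⊓ b) = stone a ∩ stone b :=
  Set.ext fun _ => PFilter.inf_mem_iff

theorem stone_sup (a b : A) : stone (a ⊔ b) = stone a ∪ stone b :=
  Set.ext fun _ => sup_mem_iff

theorem isUpperSet_stone (a : A) : IsUpperSet (stone a) := fun _ _ h hx => h hx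

/-- The prime filter given by a set that respects all finite meets and joins. -/
def ofSet (F : Set A) (htop : ⊤ ∈ F) (hbot : ⊥ ∉ F) (hinf : ∀ a b, a ⊓ b ∈ F ↔ a ∈ F ∧ b ∈ F)
    (hsup : ∀ a b, a ⊔ b ∈ F ↔ a ∈ F ∨ b ∈ F) : PriestleyDual A :=
  have hup : ∀ {a b : A}, a ≤ b → a ∈ F → b ∈ F := fun {a b} hab ha =>
    ((hinf a b).1 (by rwa [inf_eq_left.2 hab])).2
  ⟨(IsPFilter.of_def ⟨⊤, htop⟩ (fun a ha b hb =>
      ⟨a ⊓ b, (hinf a b).2 ⟨ha, hb⟩, inf_le_left, inf_le_right⟩) hup).toPFilter,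
    ⟨⟨fun _ _ hba ha hb => ha (hup hba hb), ⟨⊥, hbot⟩, fun a ha b hb =>
      ⟨a ⊔ b, fun h => ((hsup a b).1 h).elim ha hb, le_sup_left, le_sup_right⟩⟩⟩⟩

instance : CompactSpace (PriestleyDual A) := by
  refine ⟨isCompact_iff_ultrafilter_le_nhds.2 fun f _ => ?_⟩
  -- The limit of `f` consists of the elements whose Stone sets are `f`-large; it is prime because
  -- an ultrafilter containing a union contains one of its parts.
  let x : PriestleyDual A := ofSet {a | stone a ∈ f}
    (by rw [Set.mem_ofPred_eq, stone_top]; exact Filter.univ_mem) (by simp)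
    (fun a b => by simp only [Set.mem_ofPred_eq, stone_inf]; exact Filter.inter_mem_iff)
    (fun a b => by simp [stone_sup, Ultrafilter.union_mem_iff])
  refine ⟨x, trivial, ?_⟩
  rw [TopologicalSpace.nhds_generateFrom]
  refine le_iInf₂ fun W hW => Filter.le_principal_iff.2 ?_
  obtain ⟨hx, a, b, rfl⟩ := hW
  exact Filter.inter_mem hx.1 (Ultrafilter.compl_mem_iff_notMem.2 hx.2)

theorem isOpen_stone_diff (a b : A) : IsOpen (stone a \ stone b) :=
  TopologicalSpace.isOpen_generateFrom_of_mem ⟨a, b, rfl⟩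

theorem isClopen_stone (a : A) : IsClopen (stone a) := by
  refine ⟨⟨?_⟩, ?_⟩
  · simpa [Set.compl_eq_univ_sdiff] using isOpen_stone_diff ⊤ a
  · simpa using isOpen_stone_diff a ⊥

instance : PriestleySpace (PriestleyDual A) where
  priestley {x y} h := by
    obtain ⟨a, hax, hay⟩ : ∃ a ∈ x.1, a ∉ y.1 := by simpa [le_iff] using h
    exact ⟨stone a, isClopen_stone a, isUpperSet_stone a, hax, hay⟩

/-- The nontrivial direction is the prime ideal theorem, applied to the principal filter of `a` and
the principal ideal of `b`. -/
theorem stone_subset_stone {a b : A} : stone a ⊆ stone b ↔ a ≤ b := by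
  refine ⟨fun h => ?_, fun h _ => PFilter.mem_of_le h⟩
  by_contra hab
  obtain ⟨J, hJ, hbJ, haJ⟩ := DistribLattice.prime_ideal_of_disjoint_filter_ideal
    (F := PFilter.principal a) (I := Ideal.principal b)
    (Set.disjoint_left.2 fun c hac hcb => hab (le_trans hac hcb))
  let x : PriestleyDual A := ⟨hJ.toPrimePair.F, hJ.toPrimePair.F_isPrime⟩
  have hax : a ∈ x.1 := Set.disjoint_left.1 haJ (PFilter.mem_principal.2 le_rfl)
  have hbx : b ∈ x.1 := h (show x ∈ stone a from hax)
  exact Set.disjoint_left.1 hJ.toPrimePair.disjoint (hbJ (Ideal.mem_principal.2 le_rfl)) hbx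

theorem isTopologicalBasis :
    TopologicalSpace.IsTopologicalBasis
      {W : Set (PriestleyDual A) | ∃ a b : A, W = stone a \ stone b} where
  exists_subset_inter := by
    rintro _ ⟨a, b, rfl⟩ _ ⟨c, d, rfl⟩ x ⟨hx, hx'⟩
    refine ⟨_, ⟨a ⊓ c, b ⊔ d, rfl⟩, ?_, ?_⟩
    · rw [stone_inf, stone_sup]
      exact ⟨⟨hx.1, hx'.1⟩, not_or.2 ⟨hx.2, hx'.2⟩⟩
    · rw [stone_inf, stone_sup]
      exact fun y hy => ⟨⟨hy.1.1, fun h => hy.2 (Or.inl h)⟩, ⟨hy.1.2, fun h => hy.2 (Or.inr h)⟩⟩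
  sUnion_eq := Set.eq_univ_of_forall fun x =>
    ⟨stone ⊤ \ stone ⊥, ⟨⊤, ⊥, rfl⟩, by simp⟩
  eq_generateFrom := rfl

/-- A closed set is separated from a point above no element of it by a basic clopen upset. -/
theorem exists_subset_stone_of_isClosed {C : Set (PriestleyDual A)} (hC : IsClosed C)
    {y : PriestleyDual A} (hy : ∀ x ∈ C, ¬ x ≤ y) : ∃ b : A, C ⊆ stone b ∧ y ∉ stone b := by
  refine hC.isCompact.induction_on (p := fun C => ∃ b : A, C ⊆ stone b ∧ y ∉ stone b)
    ⟨⊥, by simp⟩ (fun s t hst ⟨b, hb, hyb⟩ => ⟨b, hst.trans hb, hyb⟩) ?_ fun x hx => ?_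
  · rintro s t ⟨b, hb, hyb⟩ ⟨c, hc, hyc⟩
    refine ⟨b ⊔ c, ?_, ?_⟩ <;> rw [stone_sup]
    exacts [Set.union_subset_union hb hc, not_or.2 ⟨hyb, hyc⟩]
  · obtain ⟨a, hax, hay⟩ : ∃ a ∈ x.1, a ∉ y.1 := by simpa [le_iff] using hy x hx
    exact ⟨stone a, mem_nhdsWithin_of_mem_nhds ((isClopen_stone a).2.mem_nhds hax), a, le_rfl, hay⟩

/-- An open upset is a union of basic clopen upsets. -/
theorem exists_stone_subset_of_isOpenUpset {U : Set (PriestleyDual A)} (hU : IsOpenUpset U)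
    {x : PriestleyDual A} (hx : x ∈ U) : ∃ a : A, x ∈ stone a ∧ stone a ⊆ U := by
  obtain ⟨a, hxa, haU⟩ := hU.1.isClosed_compl.isCompact.induction_on
    (p := fun C => ∃ a : A, x ∈ stone a ∧ stone a ⊆ Cᶜ) ⟨⊤, by simp⟩
    (fun s t hst ⟨a, hxa, h⟩ => ⟨a, hxa, h.trans (Set.compl_subset_compl.2 hst)⟩)
    (fun s t ⟨a, hxa, h⟩ ⟨b, hxb, h'⟩ => ⟨a ⊓ b, by
      rw [stone_inf, Set.compl_union]
      exact ⟨⟨hxa, hxb⟩, Set.inter_subset_inter h h'⟩⟩)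
    (fun y hy => by
      have hxy : ¬ x ≤ y := fun h => hy (hU.2 h hx)
      obtain ⟨a, hax, hay⟩ : ∃ a ∈ x.1, a ∉ y.1 := by simpa [le_iff] using hxy
      exact ⟨(stone a)ᶜ, mem_nhdsWithin_of_mem_nhds ((isClopen_stone a).compl.2.mem_nhds hay), a,
        hax, by simp⟩)
  exact ⟨a, hxa, by simpa using haU⟩

/-- The open upset of an arbitrary subset of the lattice. -/
def openUpset (S : Set A) : Set (PriestleyDual A) := ⋃ a ∈ S, stone a

theorem isOpenUpset_openUpset (S : Set A) : IsOpenUpset (openUpset S) :=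
  ⟨isOpen_biUnion fun a _ => (isClopen_stone a).2, isUpperSet_iUnion₂ fun a _ => isUpperSet_stone a⟩

theorem openUpset_subset_iff {S : Set A} {U : Set (PriestleyDual A)} :
    openUpset S ⊆ U ↔ ∀ a ∈ S, stone a ⊆ U := Set.iUnion₂_subset_iff

theorem openUpset_eq {U : Set (PriestleyDual A)} (hU : IsOpenUpset U) :
    openUpset {a | stone a ⊆ U} = U := by
  refine Set.Subset.antisymm (openUpset_subset_iff.2 fun _ h => h) fun x hx => ?_
  obtain ⟨a, hxa, ha⟩ := exists_stone_subset_of_isOpenUpset hU hx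
  exact Set.mem_biUnion (show a ∈ {a | stone a ⊆ U} from ha) hxa

/-- The set `cl₂ (openUpset S)` is a closed upset, hence the intersection of the sets `stone b`
containing it, and these `b` are the upper bounds of `S`. -/
theorem stone_subset_cl₂_iff {S : Set A} {c : A} :
    stone c ⊆ cl₂ (openUpset S) ↔ c ∈ lowerBounds (upperBounds S) := by
  constructor
  · intro h b hb
    refine stone_subset_stone.1 (h.trans (cl₂_minimal ?_ (isClopen_stone b).1 (isUpperSet_stone b)))
    exact openUpset_subset_iff.2 fun a ha => stone_subset_stone.2 (hb ha)
  · intro h y hy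
    by_contra hyc
    obtain ⟨b, hb, hyb⟩ := exists_subset_stone_of_isClosed (isClosed_cl₂ (openUpset S))
      (fun x hx hxy => hyc (isUpperSet_cl₂ _ hxy hx))
    refine hyb (stone_subset_stone.2 (h fun a ha => ?_) hy)
    exact stone_subset_stone.1
      ((openUpset_subset_iff.1 ((subset_cl₂ _).trans hb)) a ha)

theorem isDMSet_openUpset {S : Set A} (hS : lowerBounds (upperBounds S) ⊆ S) :
    IsDMSet (openUpset S) := by
  refine ⟨isOpenUpset_openUpset S, Set.Subset.antisymm (fun x hx => ?_)
    (subset_int₁_cl₂ (isOpenUpset_openUpset S))⟩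
  obtain ⟨c, hxc, hc⟩ := exists_stone_subset_of_isOpenUpset (int₁_isOpenUpset _) hx
  exact Set.mem_biUnion (hS (stone_subset_cl₂_iff.1 (hc.trans (int₁_subset _)))) hxc

/-- A cut is recovered from its open upset. -/
theorem stone_subset_openUpset_left_iff (N : DedekindCut A) {c : A} :
    stone c ⊆ openUpset N.left ↔ c ∈ N.left := by
  refine ⟨fun h => ?_, fun h => Set.subset_biUnion_of_mem (u := stone) h⟩
  have := stone_subset_cl₂_iff.1 (h.trans (subset_cl₂ _))
  rwa [N.upperBounds_left, N.lowerBounds_right] at this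

/-- The Dedekind-MacNeille completion of `A` is isomorphic to the lattice of DM-sets of the
Priestley space of `A`. -/
noncomputable def dedekindCutIso : DedekindCut A ≃o DMSets (PriestleyDual A) :=
  RelIso.ofSurjective
    (OrderEmbedding.ofMapLEIff
      (fun N => (⟨openUpset N.left, isDMSet_openUpset
        (by rw [N.upperBounds_left, N.lowerBounds_right])⟩ : DMSets (PriestleyDual A)))
      fun M N => by
        rw [← Concept.extent_subset_extent_iff]
        change openUpset M.left ⊆ openUpset N.left ↔ _
        simp only [openUpset_subset_iff, stone_subset_openUpset_left_iff]
        rfl)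
    (fun U => by
      -- The preimage of `U` collects all basic clopen upsets inside it; the DM condition on `U` is
      -- what makes this set normal.
      let S : Set A := {a | stone a ⊆ U.1}
      have hS : lowerBounds (upperBounds S) = S := by
        refine Set.Subset.antisymm (fun c hc => ?_) (subset_lowerBounds_upperBounds S)
        have h := stone_subset_cl₂_iff.2 hc
        rw [openUpset_eq U.2.1] at h
        change stone c ⊆ U.1
        rw [← U.2.2]
        exact int₁_maximal ⟨(isClopen_stone c).2, isUpperSet_stone c⟩ h
      refine ⟨⟨S, upperBounds S, rfl, hS⟩, Subtype.ext (openUpset_eq U.2.1)⟩)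

/-- An element lies in the relative annihilator of `a` and `b` iff its Stone set misses `stone a \
stone b`. A point of `int₁ (cl₂ U)` outside `closure U` has such a basic neighbourhood missing `U`,
and the corresponding annihilator cannot be normal. Conversely, a closure inside the complement of
`stone a \ stone b` adds nothing to the annihilator. -/
theorem isProHeyting_iff : IsProHeyting A ↔
    ∀ U : Set (PriestleyDual A), IsOpenUpset U → int₁ (cl₂ U) = int₁ (closure U) := by
  have mem_rel (a b c : A) :
      c ∈ relAnnihilator a b ↔ stone c ⊆ (stone a \ stone b)ᶜ := by
    change a ⊓ c ≤ b ↔ _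
    rw [← stone_subset_stone, stone_inf]
    refine ⟨fun h x hc hx => hx.2 (h ⟨hx.1, hc⟩), fun h x hx => ?_⟩
    by_contra hb
    exact h hx.2 ⟨hx.1, hb⟩
  simp only [int₁_cl₂_eq_iff]
  constructor
  · intro h U hU x hx
    by_contra hxU
    obtain ⟨_, ⟨a, b, rfl⟩, hxab, hab⟩ :=
      isTopologicalBasis.exists_subset_of_mem_open hxU isClosed_closure.isOpen_compl
    obtain ⟨c, hxc, hc⟩ := exists_stone_subset_of_isOpenUpset (int₁_isOpenUpset _) hx
    have hUN : {d | stone d ⊆ U} ⊆ relAnnihilator a b := fun d hd =>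
      (mem_rel a b d).2 fun y hy hyab => hab hyab (subset_closure (hd hy))
    -- Normality places `c` in the annihilator, as `stone c ⊆ cl₂ U` and `U` is covered by Stone
    -- sets of its elements. This contradicts `x ∈ stone c` lying in `stone a \ stone b`.
    have hcN : c ∈ relAnnihilator a b := by
      rw [← (h a b).2, ← stone_subset_cl₂_iff]
      refine (hc.trans (int₁_subset _)).trans (cl₂_minimal ?_ (isClosed_cl₂ _) (isUpperSet_cl₂ _))
      rw [← openUpset_eq hU]
      exact (Set.biUnion_subset_biUnion_left hUN).trans (subset_cl₂ _)
    exact (mem_rel a b c).1 hcN hxc hxab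
  · intro h a b
    refine ⟨(isDIdeal_relAnnihilator a b).1, Set.Subset.antisymm (fun c hc => ?_)
      (subset_lowerBounds_upperBounds _)⟩
    have hcl : stone c ⊆ closure (openUpset (relAnnihilator a b)) :=
      (int₁_maximal ⟨(isClopen_stone c).2, isUpperSet_stone c⟩
        (stone_subset_cl₂_iff.2 hc)).trans (h _ (isOpenUpset_openUpset _))
    refine (mem_rel a b c).2 (hcl.trans (closure_minimal ?_ (isOpen_stone_diff a b).isClosed_compl))
    exact openUpset_subset_iff.2 fun d hd => (mem_rel a b d).1 hd

end PriestleyDual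

/-! ### Transfer to the Dedekind–MacNeille completion -/

theorem isKProHeyting_iff {A : Type u} [SemilatticeInf A] {κ : Cardinal.{u}} :
    IsKProHeyting κ A ↔ IsKJD κ (DedekindCut A) := BLTower_eq_range_principal_iff

theorem isKJD_dedekindCut_iff {A : Type u} [DistribLattice A] [BoundedOrder A]
    {κ : Cardinal.{u}} : IsKJD κ (DedekindCut A) ↔
      ∀ U : Set (PriestleyDual A), IsKDMSet κ U → int₁ (cl₂ U) = int₁ (closure U) := by
  rw [← isKJD_DMSets_iff]
  exact ⟨IsKJD.orderIso PriestleyDual.dedekindCutIso,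
    IsKJD.orderIso PriestleyDual.dedekindCutIso.symm⟩

theorem isJID_dedekindCut_iff {A : Type u} [DistribLattice A] [BoundedOrder A] :
    IsJID (DedekindCut A) ↔
      ∀ U : Set (PriestleyDual A), IsOpenUpset U → int₁ (cl₂ U) = int₁ (closure U) := by
  rw [← isJID_DMSets_iff]
  exact ⟨IsJID.orderIso PriestleyDual.dedekindCutIso,
    IsJID.orderIso PriestleyDual.dedekindCutIso.symm⟩

end BrunsLakser

theorem mainTheorem11 {X : Type v} [PartialOrder X] [TopologicalSpace X] [CompactSpace X]
    [PriestleySpace X] (𝒰 : Set (BrunsLakser.DMSets X))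
    {A : Type u} [DistribLattice A] [BoundedOrder A] :
    (BrunsLakser.IsDistributiveJoin 𝒰 (sSup 𝒰) ↔
      (sSup 𝒰).1 = BrunsLakser.int₁ (closure (⋃ U ∈ 𝒰, U.1))) ∧
    (∀ κ : Cardinal.{u}, κ.IsRegular →
      (BrunsLakser.MemKJD κ (DedekindCut A) ↔
        ∀ U : Set (BrunsLakser.PriestleyDual A), BrunsLakser.IsKDMSet κ U →
          BrunsLakser.int₁ (BrunsLakser.cl₂ U) = BrunsLakser.int₁ (closure U)) ∧
      (BrunsLakser.IsKProHeyting κ A ↔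
        ∀ U : Set (BrunsLakser.PriestleyDual A), BrunsLakser.IsKDMSet κ U →
          BrunsLakser.int₁ (BrunsLakser.cl₂ U) = BrunsLakser.int₁ (closure U))) ∧
    (BrunsLakser.MemJID (DedekindCut A) ↔
      ∀ U : Set (BrunsLakser.PriestleyDual A), BrunsLakser.IsOpenUpset U →
        BrunsLakser.int₁ (BrunsLakser.cl₂ U) = BrunsLakser.int₁ (closure U)) ∧
    (BrunsLakser.IsProHeyting A ↔
      ∀ U : Set (BrunsLakser.PriestleyDual A), BrunsLakser.IsOpenUpset U →
        BrunsLakser.int₁ (BrunsLakser.cl₂ U) = BrunsLakser.int₁ (closure U)) := by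
  refine ⟨BrunsLakser.DMSets.isDistributiveJoin_iff 𝒰, fun κ hκ => ⟨?_, ?_⟩, ?_,
    BrunsLakser.PriestleyDual.isProHeyting_iff⟩
  · rw [BrunsLakser.memKJD_iff hκ.aleph0_le, BrunsLakser.isKJD_dedekindCut_iff]
  · rw [BrunsLakser.isKProHeyting_iff, BrunsLakser.isKJD_dedekindCut_iff]
  · rw [BrunsLakser.memJID_iff, BrunsLakser.isJID_dedekindCut_iff]
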